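/- Call a finite poset $(2+2)$-free if it has no induced subposet isomorphic to the disjoint union of two $2$-element chains. For $n,k\ge 0$ let $p_{n,k}$ be the number of isomorphism classes of $(2+2)$-free posets with $n$ elements of which exactly $k$ are minimal. An ascent sequence of length $n$ is a sequence $(x_1,\dots,x_n)$ of non-negative integers with $x_1=0$ and $x_i\le 1+|\{1\le j<i-1 : x_j<x_{j+1}\}|$ for $2\le i\le n$ (the empty sequence is the ascent sequence of length $0$); let $a_{n,k}$ be the number of ascent sequences of length $n$ with exactly $k$ entries equal to $0$. Then, in the ring $\mathbb Z[[t,z]]$ of formal power series, the sum on the right-hand side below converges coefficientwise, and $$\sum_{n,k\ge 0} p_{n,k}\,t^n z^k=\sum_{n,k\ge 0} a_{n,k}\,t^n z^k = 1+\sum_{n\ge 0}\frac{zt}{(1-zt)^{n+1}}\prod_{i=1}^n\bigl(1-(1-t)^i\bigr).$$ -/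

import Mathlib

open scoped MvPowerSeries.WithPiTopology

namespace FishburnMin

/-- A poset is `(2+2)`-free if it has no induced subposet isomorphic to the disjoint union of two
2-element chains. (The order on `Fin 2 ⊕ Fin 2` is the disjoint-union order.) -/
def TwoPlusTwoFree (α : Type*) [PartialOrder α] : Prop :=
  IsEmpty ((Fin 2 ⊕ Fin 2) ↪o α)

/-- The number of minimal elements of a (finite) poset. -/
noncomputable def numMin (α : Type*) [PartialOrder α] : ℕ :=
  {x : α | IsMin x}.ncard

/-- The `(2+2)`-free partial orders on the set `Fin n` with `k` minimal elements. -/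
def LabeledPoset (n k : ℕ) : Type :=
  {P : PartialOrder (Fin n) // @TwoPlusTwoFree (Fin n) P ∧ @numMin (Fin n) P = k}

/-- Isomorphism of partial orders on `Fin n`. -/
def isoSetoid (n k : ℕ) : Setoid (LabeledPoset n k) where
  r P Q := Nonempty (@OrderIso (Fin n) (Fin n) P.1.toLE Q.1.toLE)
  iseqv :=
    { refl := fun P => ⟨@OrderIso.refl (Fin n) P.1.toLE⟩
      symm := fun {P Q} h => h.map (@OrderIso.symm (Fin n) (Fin n) P.1.toLE Q.1.toLE)
      trans := fun {P Q R} h h' => h.elim fun e => h'.elim fun e' =>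
        ⟨@OrderIso.trans (Fin n) (Fin n) (Fin n) P.1.toLE Q.1.toLE R.1.toLE e e'⟩ }

/-- `p_{n,k}`: the number of unlabeled `(2+2)`-free posets of size `n` with `k` minimal elements,
that is, the number of isomorphism classes. -/
noncomputable def posetCount (n k : ℕ) : ℕ :=
  Nat.card (Quotient (isoSetoid n k))

/-- The number of ascents of a sequence: positions `j` with `x_j < x_{j+1}`. -/
def asc (x : List ℕ) : ℕ :=
  (x.zip x.tail).countP fun q => q.1 < q.2

/-- Ascent sequences: the first entry (if any) is `0`, and every later entry is at most one more
than the number of ascents of the sequence of entries before it. -/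
def IsAscentSeq (x : List ℕ) : Prop :=
  (∀ h : 0 < x.length, x[0] = 0) ∧
    ∀ (i : ℕ) (h : i < x.length), 0 < i → x[i] ≤ 1 + asc (x.take i)

/-- The number of ascent sequences of length `n` with `k` zeros. -/
noncomputable def ascentCount (n k : ℕ) : ℕ :=
  Nat.card {x : List ℕ // IsAscentSeq x ∧ x.length = n ∧ x.count 0 = k}

/-- The formal power series `∑_{n,k} c n k t^n z^k`, where `t` is the variable `X 0` and `z` is the
variable `X 1`. -/
def genFun (c : ℕ → ℕ → ℕ) : MvPowerSeries (Fin 2) ℤ :=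
  fun d => (c (d 0) (d 1) : ℤ)

/-- The variable `t`. -/
noncomputable def t : MvPowerSeries (Fin 2) ℤ := MvPowerSeries.X 0

/-- The variable `z`. -/
noncomputable def z : MvPowerSeries (Fin 2) ℤ := MvPowerSeries.X 1

/-- The summand `zt / (1 - zt)^(n+1) * ∏_{i=1}^n (1 - (1-t)^i)`. The inverse of `1 - zt`, a power
series with constant coefficient `1`, is the inverse in the ring of formal power series. -/
noncomputable def term (n : ℕ) : MvPowerSeries (Fin 2) ℤ :=
  z * t * (MvPowerSeries.invOfUnit (1 - z * t) 1) ^ (n + 1) *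
    ∏ i ∈ Finset.Icc 1 n, (1 - (1 - t) ^ i)

end FishburnMin

/-!
Both generating functions are computed in an arbitrary commutative ring with elements `t`, `z`, `u`
such that `t^(N+1) = 0` and `u = 1 / (1 - z t)`; the quotients of `ℤ[[t, z]]` by the ideals
`(t^(N+1))` then give the theorem.

Ascent sequences. Let `μ` be the linear functional that sends `X^n` to
`u^(n+1) ∏_{i=1}^n (1 - (1-t)^i)`. Put `g = 1 / (1 - X)` and `r = (1 - X) / (1 - (1-t) X)`. Then
`μ (g^(a+1) r^l)` counts the ways to continue an ascent sequence with `a` ascents and last entry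
`l`: as `1 = r ((1-t) + t g)`, raising `l` to `l + 1` has the right effect, and for `l = 0` the
recursion telescopes to `X f = k - k((1-t) X)` with `k = g^(a+1)`, to which `μ` is adapted.

Posets. A finite `(2+2)`-free poset has a unique representation by intervals whose left endpoints
are exactly `0, …, m - 1`, and likewise their right endpoints. The multiplicities of the intervals
form an upper triangular matrix without zero rows and columns, whose first row counts the minimal
elements. Let `Φ(a)` be the generating function of these matrices beneath an auxiliary row of
entries of total weight `a`. Splitting off the first row gives `a Φ(a) = 1 + (a v - 1) Φ(a v)`
with `v = 1 / (1 - t)`. This equation has only one solution, since `t` divides `a v - 1` whenever it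
divides `a - 1`, and `∑ a^n ∏_{i=1}^n (1 - (1-t)^i)` solves it.
-/

namespace FishburnMin

/-! ### Truncated series -/

section Truncation

variable {Q : Type*} [CommRing Q]

/-- The `q`-Pochhammer symbol `(q; q)_n`. -/
def qPochhammer (q : Q) (n : ℕ) : Q := ∏ i ∈ Finset.Icc 1 n, (1 - q ^ i)

lemma qPochhammer_zero (q : Q) : qPochhammer q 0 = 1 := by simp [qPochhammer]

lemma qPochhammer_succ (q : Q) (n : ℕ) :
    qPochhammer q (n + 1) = qPochhammer q n * (1 - q ^ (n + 1)) :=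
  Finset.prod_Icc_succ_top (by omega) _

lemma one_sub_pow_dvd_qPochhammer (q : Q) (n : ℕ) : (1 - q) ^ n ∣ qPochhammer q n := by
  simpa [qPochhammer] using
    Finset.prod_dvd_prod_of_dvd (s := Finset.Icc 1 n) (fun _ => 1 - q) (fun i => 1 - q ^ i)
      fun i _ => one_sub_dvd_one_sub_pow q i

lemma eq_zero_of_pow_dvd {t x : Q} {N n : ℕ} (ht : t ^ (N + 1) = 0) (hn : N < n)
    (h : t ^ n ∣ x) : x = 0 :=
  zero_dvd_iff.1 (pow_eq_zero_of_le hn ht ▸ h)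

/-- The sum of the terms `c n k t^n z^k` with `n ≤ N` and `k ≤ N`; for counting functions `c` that
vanish when `n < k`, this is `∑ c n k t^n z^k` modulo `t^(N+1)`. -/
def truncGenFun (c : ℕ → ℕ → ℕ) (N : ℕ) (t z : Q) : Q :=
  ∑ n ∈ Finset.range (N + 1), ∑ k ∈ Finset.range (N + 1), (c n k : Q) * (t ^ n * z ^ k)

/-- The right-hand side of the theorem modulo `t^(N+1)`, with `u` in place of `1 / (1 - z t)`. -/
def truncSeries (N : ℕ) (t z u : Q) : Q :=
  1 + z * t * ∑ n ∈ Finset.range (N + 1), u ^ (n + 1) * qPochhammer (1 - t) n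

lemma truncGenFun_eq_sum {ι : Type*} {c : ℕ → ℕ → ℕ} {N : ℕ} {t : Q} (z : Q)
    (ht : t ^ (N + 1) = 0) (s : Finset ι) (size zeros : ι → ℕ)
    (hle : ∀ p ∈ s, zeros p ≤ size p)
    (hc : ∀ n ≤ N, ∀ k, c n k = (s.filter fun p => size p = n ∧ zeros p = k).card) :
    truncGenFun c N t z = ∑ p ∈ s, t ^ size p * z ^ zeros p := by
  have hsum (p : ι) (hp : p ∈ s) :
      ∑ n ∈ Finset.range (N + 1), ∑ k ∈ Finset.range (N + 1),
        (if size p = n ∧ zeros p = k then t ^ n * z ^ k else 0) = t ^ size p * z ^ zeros p := by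
    have := hle p hp
    rcases le_or_gt (size p) N with h | h
    · simp only [ite_and, Finset.sum_ite_irrel, Finset.sum_const_zero, Finset.sum_ite_eq,
        Finset.mem_range]
      rw [if_pos (by omega), if_pos (by omega)]
    · rw [pow_eq_zero_of_le h ht, zero_mul]
      refine Finset.sum_eq_zero fun n hn => Finset.sum_eq_zero fun k _ => if_neg ?_
      have := Finset.mem_range.1 hn
      omega
  rw [← Finset.sum_congr rfl hsum, Finset.sum_comm, truncGenFun]
  refine Finset.sum_congr rfl fun n hn => ?_
  rw [Finset.sum_comm]
  refine Finset.sum_congr rfl fun k _ => ?_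
  rw [hc n (Nat.lt_succ_iff.1 (Finset.mem_range.1 hn)) k, ← Finset.sum_filter, Finset.sum_const,
    nsmul_eq_mul]

end Truncation

/-! ### The moment functional -/

section Moment

variable {Q : Type*} [CommRing Q]

open PowerSeries

/-- The linear functional on power series that sends `X ^ n` to `u^(n+1) (q; q)_n` for `n ≤ N` and
to `0` for `n > N`. -/
noncomputable def moment (q u : Q) (N : ℕ) : Q⟦X⟧ →ₗ[Q] Q :=
  ∑ n ∈ Finset.range (N + 1), (u ^ (n + 1) * qPochhammer q n) • coeff n

lemma moment_apply (q u : Q) (N : ℕ) (f : Q⟦X⟧) :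
    moment q u N f = ∑ n ∈ Finset.range (N + 1), u ^ (n + 1) * qPochhammer q n * coeff n f := by
  simp [moment, LinearMap.sum_apply]

lemma moment_C_mul (q u : Q) (N : ℕ) (c : Q) (f : Q⟦X⟧) :
    moment q u N (C c * f) = c * moment q u N f := by
  rw [← smul_eq_C_mul, map_smul, smul_eq_mul]

lemma moment_eq_of_X_mul_eq {q u w : Q} {N : ℕ} (hq : (1 - q) ^ (N + 1) = 0) (hu : w * u = 1)
    {k f : Q⟦X⟧} (hf : X * f = k - rescale q k) :
    w * moment q u N k = coeff 0 k + moment q u N f := by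
  have hcoeff (n : ℕ) : coeff n f = (1 - q ^ (n + 1)) * coeff (n + 1) k := by
    rw [← coeff_succ_X_mul, hf, map_sub, coeff_rescale]
    ring
  have hlast : qPochhammer q (N + 1) = 0 :=
    eq_zero_of_pow_dvd hq N.lt_succ_self (one_sub_pow_dvd_qPochhammer q _)
  calc w * moment q u N k
      = ∑ n ∈ Finset.range (N + 1), u ^ n * qPochhammer q n * coeff n k := by
        rw [moment_apply, Finset.mul_sum]
        refine Finset.sum_congr rfl fun n _ => ?_
        linear_combination (u ^ n * qPochhammer q n * coeff n k) * hu
    _ = coeff 0 k + ∑ n ∈ Finset.range (N + 1),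
          u ^ (n + 1) * qPochhammer q (n + 1) * coeff (n + 1) k := by
        rw [Finset.sum_range_succ', Finset.sum_range_succ _ N, hlast, qPochhammer_zero]
        ring
    _ = coeff 0 k + moment q u N f := by
        rw [moment_apply]
        refine congrArg _ (Finset.sum_congr rfl fun n _ => ?_)
        rw [hcoeff, qPochhammer_succ]
        ring

/-- The geometric series `1 / (1 - c X)`. -/
noncomputable def geomSeries (c : Q) : Q⟦X⟧ := mk fun n => c ^ n

lemma geomSeries_mul (c : Q) : geomSeries c * (1 - C c * X) = 1 := by
  ext (_ | n)
  · simp [geomSeries]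
  · rw [mul_sub, mul_one, map_sub, mul_left_comm, coeff_C_mul, coeff_succ_mul_X]
    simp [geomSeries, pow_succ', coeff_one]

lemma geomSeries_one_mul : geomSeries (1 : Q) * (1 - X) = 1 := by
  simpa using geomSeries_mul (1 : Q)

lemma rescale_geomSeries_one (c : Q) : rescale c (geomSeries 1) = geomSeries c := by
  ext n
  simp [geomSeries, coeff_rescale]

/-- The power series `(1 / (1 - X))^(a+1) ((1 - X) / (1 - q X))^l`. With `q = 1 - t`, its image
under `moment` is the generating function of the ways to continue an ascent sequence with `a`
ascents and last entry `l`. -/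
noncomputable def contSeries (q : Q) (a l : ℕ) : Q⟦X⟧ :=
  geomSeries 1 ^ (a + 1) * ((1 - X) * geomSeries q) ^ l

lemma coeff_zero_contSeries_zero (q : Q) (a : ℕ) : coeff 0 (contSeries q a 0) = 1 := by
  simp [contSeries, geomSeries, coeff_zero_eq_constantCoeff_apply]

lemma contSeries_succ_succ (q : Q) (a l : ℕ) :
    contSeries q (a + 1) (l + 1) = contSeries q a l * geomSeries q := by
  unfold contSeries
  linear_combination
    (geomSeries 1 ^ (a + 1) * ((1 - X) * geomSeries q) ^ l * geomSeries q) *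
      geomSeries_one_mul (Q := Q)

lemma contSeries_succ_right (q : Q) (a l : ℕ) :
    contSeries q a (l + 1) = (1 - X) * (contSeries q a l * geomSeries q) := by
  unfold contSeries
  ring

lemma contSeries_self_succ (q : Q) (a : ℕ) :
    contSeries q a (a + 1) = rescale q (contSeries q a 0) := by
  rw [contSeries, ← mul_pow, ← mul_assoc, geomSeries_one_mul, one_mul, contSeries, pow_zero,
    mul_one, map_pow, rescale_geomSeries_one]

lemma contSeries_eq_add (q : Q) (a l : ℕ) :
    contSeries q a l = C q * contSeries q a (l + 1) + C (1 - q) * contSeries q (a + 1) (l + 1) := by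
  rw [contSeries_succ_succ, contSeries_succ_right, map_sub, map_one]
  linear_combination -contSeries q a l * geomSeries_mul q

lemma X_mul_contSeries (q : Q) (a l : ℕ) :
    X * (C (1 - q) * contSeries q (a + 1) (l + 1))
      = contSeries q a l - contSeries q a (l + 1) := by
  rw [contSeries_succ_succ, contSeries_succ_right, map_sub, map_one]
  linear_combination contSeries q a l * geomSeries_mul q

/-- The generating function (up to order `N` in `t`) of the ways to continue an ascent sequence
with `a` ascents and last entry `l`, where `u` stands for `1 / (1 - z t)`. -/
noncomputable def contWeight (t u : Q) (N a l : ℕ) : Q :=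
  moment (1 - t) u N (contSeries (1 - t) a l)

lemma contWeight_zero_zero (t u : Q) (N : ℕ) :
    contWeight t u N 0 0 = ∑ n ∈ Finset.range (N + 1), u ^ (n + 1) * qPochhammer (1 - t) n := by
  simp [contWeight, contSeries, moment_apply, geomSeries]

lemma contWeight_eq_add (t u : Q) (N a l : ℕ) :
    contWeight t u N a l
      = (1 - t) * contWeight t u N a (l + 1) + t * contWeight t u N (a + 1) (l + 1) := by
  simp only [contWeight]
  rw [contSeries_eq_add, map_add, moment_C_mul, moment_C_mul, sub_sub_cancel]

lemma contWeight_zero_right {t z u : Q} {N : ℕ} (ht : t ^ (N + 1) = 0) (hu : (1 - z * t) * u = 1)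
    (a : ℕ) : contWeight t u N a 0
      = 1 + t * (z * contWeight t u N a 0
        + ∑ l ∈ Finset.range (a + 1), contWeight t u N (a + 1) (l + 1)) := by
  have htelescope : X * ∑ l ∈ Finset.range (a + 1),
        C (1 - (1 - t)) * contSeries (1 - t) (a + 1) (l + 1)
      = contSeries (1 - t) a 0 - rescale (1 - t) (contSeries (1 - t) a 0) := by
    simp only [Finset.mul_sum, X_mul_contSeries]
    rw [Finset.sum_range_sub', contSeries_self_succ]
  have hmoment := moment_eq_of_X_mul_eq (by rwa [sub_sub_cancel]) hu htelescope
  simp only [coeff_zero_contSeries_zero, map_sum, moment_C_mul, sub_sub_cancel,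
    ← Finset.mul_sum] at hmoment
  simp only [contWeight]
  linear_combination hmoment

lemma contWeight_rec {t z u : Q} {N : ℕ} (ht : t ^ (N + 1) = 0) (hu : (1 - z * t) * u = 1)
    (a : ℕ) {l : ℕ} (hl : l ≤ a + 1) : contWeight t u N a l
      = 1 + t * (z * contWeight t u N a 0
        + ∑ i ∈ Finset.range l, contWeight t u N a (i + 1)
        + ∑ i ∈ Finset.Ico l (a + 1), contWeight t u N (a + 1) (i + 1)) := by
  induction l with
  | zero => simpa using contWeight_zero_right ht hu a
  | succ l ih =>
    have h := ih (by omega)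
    rw [Finset.sum_eq_sum_Ico_succ_bot (by omega)] at h
    rw [Finset.sum_range_succ]
    linear_combination h - contWeight_eq_add t u N a l

end Moment

/-! ### Ascent sequences -/

section AscentSequences

lemma asc_append_singleton (x : List ℕ) (hx : x ≠ []) (v : ℕ) :
    asc (x ++ [v]) = asc x + if x.getLast hx < v then 1 else 0 := by
  induction x with
  | nil => exact absurd rfl hx
  | cons a x ih =>
    cases x with
    | nil => by_cases h : a < v <;> simp [asc, h]
    | cons b x =>
      have := ih (by simp)
      simp only [asc, List.cons_append, List.tail_cons, List.zip_cons_cons, List.countP_cons,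
        List.getLast_cons_cons] at this ⊢
      rw [this, add_right_comm]
      rfl

/-- The largest entry that may follow the ascent sequence `x`. -/
def nextBound (x : List ℕ) : ℕ := if x = [] then 0 else asc x + 1

lemma nextBound_nil : nextBound [] = 0 := if_pos rfl

lemma nextBound_of_ne_nil {x : List ℕ} (hx : x ≠ []) : nextBound x = asc x + 1 := if_neg hx

lemma isAscentSeq_nil : IsAscentSeq [] := by simp [IsAscentSeq]

lemma isAscentSeq_append_singleton (x : List ℕ) (v : ℕ) :
    IsAscentSeq (x ++ [v]) ↔ IsAscentSeq x ∧ v ≤ nextBound x := by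
  rcases eq_or_ne x [] with rfl | hx
  · simp [IsAscentSeq, nextBound_nil]
  have hpos : 0 < x.length := List.length_pos_iff.2 hx
  rw [nextBound_of_ne_nil hx, add_comm]
  constructor
  · rintro ⟨hfirst, hnext⟩
    refine ⟨⟨fun _ => ?_, fun i hi hi0 => ?_⟩, by simpa using hnext x.length (by simp) hpos⟩
    · simpa [List.getElem_append_left hpos] using hfirst (by simp)
    · have := hnext i (by simp; omega) hi0
      rwa [List.getElem_append_left hi, List.take_append_of_le_length hi.le] at this
  · rintro ⟨⟨hfirst, hnext⟩, hv⟩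
    refine ⟨fun _ => by simpa [List.getElem_append_left hpos] using hfirst hpos,
      fun i hi hi0 => ?_⟩
    rcases (Nat.lt_succ_iff.1 (by simpa using hi)).lt_or_eq with hlt | rfl
    · rw [List.getElem_append_left hlt, List.take_append_of_le_length hlt.le]
      exact hnext i hlt hi0
    · simpa using hv

lemma IsAscentSeq.getLast_le_asc {x : List ℕ} (h : IsAscentSeq x) (hx : x ≠ []) :
    x.getLast hx ≤ asc x := by
  induction x using List.reverseRecOn with
  | nil => exact absurd rfl hx
  | append_singleton x v ih =>
    obtain ⟨hseq, hv⟩ := (isAscentSeq_append_singleton x v).1 h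
    rw [List.getLast_append_singleton]
    rcases eq_or_ne x [] with rfl | hne
    · rw [nextBound_nil] at hv
      omega
    · rw [nextBound_of_ne_nil hne] at hv
      have := ih hseq hne
      rw [asc_append_singleton x hne]
      split_ifs <;> omega

/-- The finite set of ascent sequences of length `n`. -/
def ascentSeqs : ℕ → Finset (List ℕ)
  | 0 => {[]}
  | n + 1 => ((ascentSeqs n).sigma fun x => Finset.range (nextBound x + 1)).image
      fun p => p.1 ++ [p.2]

lemma mem_ascentSeqs {n : ℕ} {x : List ℕ} :
    x ∈ ascentSeqs n ↔ IsAscentSeq x ∧ x.length = n := by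
  induction n generalizing x with
  | zero =>
    simp only [ascentSeqs, Finset.mem_singleton, List.length_eq_zero_iff]
    exact ⟨fun h => ⟨h ▸ isAscentSeq_nil, h⟩, And.right⟩
  | succ n ih =>
    simp only [ascentSeqs, Finset.mem_image, Finset.mem_sigma, Finset.mem_range, ih, Sigma.exists,
      Nat.lt_succ_iff]
    constructor
    · rintro ⟨y, v, ⟨⟨hy, rfl⟩, hv⟩, rfl⟩
      exact ⟨(isAscentSeq_append_singleton y v).2 ⟨hy, hv⟩, by simp⟩
    · rintro ⟨hx, hlen⟩
      obtain ⟨y, v, rfl⟩ := x.eq_nil_or_concat'.resolve_left (by rintro rfl; simp at hlen)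
      obtain ⟨hy, hv⟩ := (isAscentSeq_append_singleton y v).1 hx
      exact ⟨y, v, ⟨⟨hy, by simpa using hlen⟩, hv⟩, rfl⟩

lemma sum_ascentSeqs_succ {M : Type*} [AddCommMonoid M] (n : ℕ) (f : List ℕ → M) :
    ∑ x ∈ ascentSeqs (n + 1), f x
      = ∑ x ∈ ascentSeqs n, ∑ v ∈ Finset.range (nextBound x + 1), f (x ++ [v]) := by
  rw [ascentSeqs, Finset.sum_image, Finset.sum_sigma]
  rintro ⟨x, v⟩ _ ⟨y, w⟩ _ h
  obtain ⟨rfl, h⟩ := List.append_inj' h rfl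
  simpa using h

/-- The finite set of ascent sequences of length at most `N`. -/
def ascentSeqsUpTo (N : ℕ) : Finset (List ℕ) := (Finset.range (N + 1)).biUnion ascentSeqs

lemma mem_ascentSeqsUpTo {N : ℕ} {x : List ℕ} :
    x ∈ ascentSeqsUpTo N ↔ IsAscentSeq x ∧ x.length ≤ N := by
  simp only [ascentSeqsUpTo, Finset.mem_biUnion, Finset.mem_range, mem_ascentSeqs, Nat.lt_succ_iff]
  exact ⟨fun ⟨_, hn, hx, hlen⟩ => ⟨hx, hlen.trans_le hn⟩, fun ⟨hx, hn⟩ => ⟨_, hn, hx, rfl⟩⟩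

lemma ascentCount_eq_card {n N : ℕ} (hn : n ≤ N) (k : ℕ) :
    ascentCount n k
      = ((ascentSeqsUpTo N).filter fun x => x.length = n ∧ x.count 0 = k).card := by
  refine Nat.subtype_card _ fun x => ?_
  rw [Finset.mem_filter, mem_ascentSeqsUpTo]
  exact ⟨fun h => ⟨h.1.1, h.2⟩, fun h => ⟨⟨h.1, h.2.1.trans_le hn⟩, h.2⟩⟩

variable {Q : Type*} [CommRing Q]

/-- The generating function (up to order `N` in `t`) of all ways to continue the ascent sequence
`x`; every new entry contributes a factor `t`, and a further factor `z` if it is `0`. -/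
noncomputable def stateWeight (t z u : Q) (N : ℕ) : List ℕ → Q
  | [] => truncSeries N t z u
  | a :: x => contWeight t u N (asc (a :: x)) ((a :: x).getLast (List.cons_ne_nil a x))

lemma stateWeight_of_ne_nil (t z u : Q) (N : ℕ) {x : List ℕ} (hx : x ≠ []) :
    stateWeight t z u N x = contWeight t u N (asc x) (x.getLast hx) := by
  cases x with
  | nil => exact absurd rfl hx
  | cons a x => rfl

lemma stateWeight_append_singleton (t z u : Q) (N : ℕ) {x : List ℕ} (hx : x ≠ []) (v : ℕ) :
    stateWeight t z u N (x ++ [v])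
      = contWeight t u N (asc x + if x.getLast hx < v then 1 else 0) v := by
  rw [stateWeight_of_ne_nil t z u N (by simp), asc_append_singleton x hx,
    List.getLast_append_singleton]

lemma stateWeight_rec {t z u : Q} {N : ℕ} (ht : t ^ (N + 1) = 0) (hu : (1 - z * t) * u = 1)
    {x : List ℕ} (h : IsAscentSeq x) :
    stateWeight t z u N x = 1 + ∑ v ∈ Finset.range (nextBound x + 1),
      (t * if v = 0 then z else 1) * stateWeight t z u N (x ++ [v]) := by
  rcases eq_or_ne x [] with rfl | hx
  · simp [nextBound_nil, stateWeight, truncSeries, asc, contWeight_zero_zero, mul_comm]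
  have hlast := h.getLast_le_asc hx
  have hlow (v : ℕ) (hv : v ∈ Finset.range (x.getLast hx)) :
      stateWeight t z u N (x ++ [v + 1]) = contWeight t u N (asc x) (v + 1) := by
    rw [stateWeight_append_singleton t z u N hx, if_neg (by simp at hv; omega), add_zero]
  have hhigh (v : ℕ) (hv : v ∈ Finset.Ico (x.getLast hx) (asc x + 1)) :
      stateWeight t z u N (x ++ [v + 1]) = contWeight t u N (asc x + 1) (v + 1) := by
    rw [stateWeight_append_singleton t z u N hx, if_pos (by simp at hv; omega)]
  rw [nextBound_of_ne_nil hx, Finset.sum_range_succ',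
    ← Finset.sum_range_add_sum_Ico _ (by omega : x.getLast hx ≤ asc x + 1)]
  simp only [Nat.add_one_ne_zero, if_false, if_true, mul_one, ← Finset.mul_sum]
  rw [Finset.sum_congr rfl hlow, Finset.sum_congr rfl hhigh, stateWeight_of_ne_nil t z u N hx,
    stateWeight_append_singleton t z u N hx, if_neg (Nat.not_lt_zero _), add_zero,
    contWeight_rec ht hu (asc x) (by omega)]
  ring

lemma pow_length_mul_pow_count_append_singleton (t z : Q) (x : List ℕ) (v : ℕ) :
    t ^ (x ++ [v]).length * z ^ (x ++ [v]).count 0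
      = t ^ x.length * z ^ x.count 0 * (t * if v = 0 then z else 1) := by
  by_cases hv : v = 0
  · simp [hv, List.count_append, pow_succ]
    ring
  · simp [hv, List.count_append, pow_succ]
    ring

lemma sum_ascentSeqs_add_stateWeight {t z u : Q} {N : ℕ} (ht : t ^ (N + 1) = 0)
    (hu : (1 - z * t) * u = 1) (n : ℕ) :
    ∑ i ∈ Finset.range n, ∑ x ∈ ascentSeqs i, t ^ x.length * z ^ x.count 0
      + ∑ x ∈ ascentSeqs n, t ^ x.length * z ^ x.count 0 * stateWeight t z u N x
      = truncSeries N t z u := by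
  induction n with
  | zero => simp [ascentSeqs, stateWeight]
  | succ n ih =>
    rw [← ih, Finset.sum_range_succ, sum_ascentSeqs_succ, add_assoc, ← Finset.sum_add_distrib]
    refine congrArg _ (Finset.sum_congr rfl fun x hx => ?_)
    rw [stateWeight_rec ht hu (mem_ascentSeqs.1 hx).1, mul_add, mul_one, Finset.mul_sum]
    simp only [pow_length_mul_pow_count_append_singleton, mul_assoc]

theorem truncGenFun_ascentCount {t z u : Q} {N : ℕ} (ht : t ^ (N + 1) = 0)
    (hu : (1 - z * t) * u = 1) : truncGenFun ascentCount N t z = truncSeries N t z u := by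
  have hdisj : (Finset.range (N + 1) : Set ℕ).PairwiseDisjoint ascentSeqs :=
    fun m _ n _ hmn => Finset.disjoint_left.2 fun x hm hn =>
      hmn ((mem_ascentSeqs.1 hm).2.symm.trans (mem_ascentSeqs.1 hn).2)
  have hlong : ∑ x ∈ ascentSeqs (N + 1), t ^ x.length * z ^ x.count 0 * stateWeight t z u N x = 0 :=
    Finset.sum_eq_zero fun x hx => by rw [(mem_ascentSeqs.1 hx).2, ht, zero_mul, zero_mul]
  rw [truncGenFun_eq_sum z ht (ascentSeqsUpTo N) List.length (List.count 0)
      (fun _ _ => List.count_le_length) fun _ hn k => ascentCount_eq_card hn k,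
    ascentSeqsUpTo, Finset.sum_biUnion hdisj, ← sum_ascentSeqs_add_stateWeight ht hu (N + 1),
    hlong, add_zero]

end AscentSequences

/-! ### Interval representations of `(2+2)`-free posets -/

section CanonicalRepresentation

lemma twoPlusTwoFree_iff {α : Type*} [PartialOrder α] :
    TwoPlusTwoFree α ↔ ∀ a b c d : α, a < b → c < d → a < d ∨ c < b := by
  constructor
  · intro h a b c d hab hcd
    by_contra! hn
    obtain ⟨had, hcb⟩ := hn
    have had' : ¬ a ≤ d := fun h => h.lt_or_eq.elim had fun e => hcb (hcd.trans (e ▸ hab))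
    have hcb' : ¬ c ≤ b := fun h => h.lt_or_eq.elim hcb fun e => had (hab.trans (e ▸ hcd))
    refine h.false (OrderEmbedding.ofMapLEIff (Sum.elim ![a, b] ![c, d]) ?_)
    rintro (x | x) (y | y) <;> fin_cases x <;> fin_cases y <;> simp <;> grind
  · refine fun h => ⟨fun f => ?_⟩
    have := h (f (.inl 0)) (f (.inl 1)) (f (.inr 0)) (f (.inr 1)) (by simp) (by simp)
    simp at this

lemma TwoPlusTwoFree.Iio_subset_or_subset {α : Type*} [PartialOrder α] (h : TwoPlusTwoFree α)
    (x y : α) : Set.Iio x ⊆ Set.Iio y ∨ Set.Iio y ⊆ Set.Iio x := by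
  by_contra! hn
  obtain ⟨⟨a, hax, hay⟩, b, hby, hbx⟩ := hn.imp Set.not_subset.1 Set.not_subset.1
  exact (twoPlusTwoFree_iff.1 h a x b y hax hby).elim hay hbx

/-- A canonical representation of a poset as an interval order: `x` is sent to the endpoints of an
interval, `x < y` means that the interval of `x` lies to the left of that of `y`, and `0, …, m - 1`
are exactly the left endpoints and exactly the right endpoints. -/
structure IsCanonicalRep {α : Type*} [LT α] (m : ℕ) (f : α → ℕ × ℕ) : Prop where
  lt_iff : ∀ x y, x < y ↔ (f x).2 < (f y).1
  range_fst : Set.range (fun x => (f x).1) = Set.Iio m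
  range_snd : Set.range (fun x => (f x).2) = Set.Iio m

lemma le_of_isLowerSet_range {α : Type*} {f g : α → ℕ} (hf : IsLowerSet (Set.range f))
    (h : ∀ x y, f x < f y → g x < g y) : f ≤ g := by
  intro x
  induction hx : f x using Nat.strong_induction_on generalizing x with
  | _ i ih =>
    rcases i.eq_zero_or_pos with rfl | hi
    · exact Nat.zero_le _
    obtain ⟨y, hy⟩ := hf (hx ▸ Nat.sub_le i 1) (Set.mem_range_self x)
    have hle := ih (i - 1) (by omega) y (hx ▸ hy)
    exact (Nat.le_add_of_sub_le hle).trans (h y x (by omega))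

lemma eq_of_le_iff_le {α : Type*} {f g : α → ℕ} (hf : IsLowerSet (Set.range f))
    (hg : IsLowerSet (Set.range g)) (h : ∀ x y, f x ≤ f y ↔ g x ≤ g y) : f = g :=
  (le_of_isLowerSet_range hf fun x y => (lt_iff_lt_of_le_iff_le (h y x)).1).antisymm
    (le_of_isLowerSet_range hg fun x y => (lt_iff_lt_of_le_iff_le (h y x)).2)

namespace IsCanonicalRep

section Preorder

variable {α : Type*} [Preorder α] {m : ℕ} {f : α → ℕ × ℕ}

lemma fst_le_snd (hf : IsCanonicalRep m f) (x : α) : (f x).1 ≤ (f x).2 :=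
  not_lt.1 fun h => lt_irrefl x ((hf.lt_iff x x).2 h)

lemma fst_le_fst_iff (hf : IsCanonicalRep m f) {x y : α} :
    (f x).1 ≤ (f y).1 ↔ Set.Iio x ⊆ Set.Iio y := by
  refine ⟨fun h w hw => (hf.lt_iff w y).2 (((hf.lt_iff w x).1 hw).trans_le h), fun h => ?_⟩
  by_contra! hlt
  obtain ⟨w, hw⟩ := hf.range_snd.ge (hf.range_fst.le ⟨y, rfl⟩)
  exact (((hf.lt_iff w y).1 (h ((hf.lt_iff w x).2 (hw.trans_lt hlt)))).trans_eq hw.symm).false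

lemma snd_le_snd_iff (hf : IsCanonicalRep m f) {x y : α} :
    (f x).2 ≤ (f y).2 ↔ Set.Ioi y ⊆ Set.Ioi x := by
  refine ⟨fun h w hw => (hf.lt_iff x w).2 (h.trans_lt ((hf.lt_iff y w).1 hw)), fun h => ?_⟩
  by_contra! hlt
  obtain ⟨w, hw⟩ := hf.range_fst.ge (hf.range_snd.le ⟨x, rfl⟩)
  exact (((hf.lt_iff x w).1 (h ((hf.lt_iff y w).2 (hlt.trans_eq hw.symm)))).trans_eq hw).false

lemma fst_eq_zero_iff (hf : IsCanonicalRep m f) {x : α} : (f x).1 = 0 ↔ IsMin x := by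
  rw [isMin_iff_forall_not_lt]
  refine ⟨fun h w hw => Nat.not_lt_zero _ (h ▸ (hf.lt_iff w x).1 hw), fun h => ?_⟩
  by_contra hx
  have hm : (f x).1 < m := hf.range_fst.le ⟨x, rfl⟩
  obtain ⟨w, hw⟩ := hf.range_snd.ge (Nat.zero_lt_of_lt hm)
  exact h w ((hf.lt_iff w x).2 (hw.trans_lt (Nat.pos_of_ne_zero hx)))

theorem unique (hf : IsCanonicalRep m f) {n : ℕ} {g : α → ℕ × ℕ} (hg : IsCanonicalRep n g) :
    f = g := by
  have hfst := eq_of_le_iff_le (hf.range_fst ▸ isLowerSet_Iio m) (hg.range_fst ▸ isLowerSet_Iio n)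
    fun x y => hf.fst_le_fst_iff.trans hg.fst_le_fst_iff.symm
  have hsnd := eq_of_le_iff_le (hf.range_snd ▸ isLowerSet_Iio m) (hg.range_snd ▸ isLowerSet_Iio n)
    fun x y => hf.snd_le_snd_iff.trans hg.snd_le_snd_iff.symm
  exact funext fun x => Prod.ext (congrFun hfst x) (congrFun hsnd x)

lemma comp_orderIso (hf : IsCanonicalRep m f) {β : Type*} [Preorder β] (e : β ≃o α) :
    IsCanonicalRep m (f ∘ e) where
  lt_iff _ _ := e.lt_iff_lt.symm.trans (hf.lt_iff _ _)
  range_fst := (e.surjective.range_comp fun x => (f x).1).trans hf.range_fst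
  range_snd := (e.surjective.range_comp fun x => (f x).2).trans hf.range_snd

end Preorder

lemma twoPlusTwoFree {α : Type*} [PartialOrder α] {m : ℕ} {f : α → ℕ × ℕ}
    (hf : IsCanonicalRep m f) : TwoPlusTwoFree α := by
  simp only [twoPlusTwoFree_iff, hf.lt_iff]
  omega

end IsCanonicalRep

section DenseRank

variable {α : Type*} [Fintype α]

/-- The position of the value `k x` among the values of `k`, without gaps. -/
def denseRank (k : α → ℕ) (x : α) : ℕ :=
  ((Finset.univ.image k).orderIsoOfFin rfl).symm
    ⟨k x, Finset.mem_image_of_mem k (Finset.mem_univ x)⟩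

lemma denseRank_le_denseRank_iff (k : α → ℕ) {x y : α} :
    denseRank k x ≤ denseRank k y ↔ k x ≤ k y :=
  ((Finset.univ.image k).orderIsoOfFin rfl).symm.le_iff_le

lemma range_denseRank (k : α → ℕ) :
    Set.range (denseRank k) = Set.Iio (Finset.univ.image k).card := by
  ext i
  refine ⟨by rintro ⟨x, rfl⟩; exact Fin.is_lt _, fun hi => ?_⟩
  obtain ⟨x, -, hx⟩ := Finset.mem_image.1 ((Finset.univ.image k).orderIsoOfFin rfl ⟨i, hi⟩).2
  refine ⟨x, ?_⟩
  simp only [denseRank, hx, Subtype.coe_eta, OrderIso.symm_apply_apply]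

end DenseRank

section Existence

variable {α : Type*} [Fintype α] [PartialOrder α]

/-- The position of the strict down-set of `x` among all strict principal down-sets. In a
`(2+2)`-free poset these form a chain, so they may be compared by their sizes. -/
noncomputable def level (x : α) : ℕ := denseRank (fun y : α => (Set.Iio y).ncard) x

open Classical in
/-- The largest level of an element that is not above `x`. -/
noncomputable def reach (x : α) : ℕ := (Finset.univ.filter fun w => ¬ x < w).sup level

variable (α) in
/-- The number of distinct strict principal down-sets of a `(2+2)`-free poset. -/
noncomputable def numLevels : ℕ := (Finset.univ.image fun y : α => (Set.Iio y).ncard).card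

lemma range_level : Set.range (level : α → ℕ) = Set.Iio (numLevels α) := range_denseRank _

lemma level_le_level_iff (h : TwoPlusTwoFree α) {x y : α} :
    level x ≤ level y ↔ Set.Iio x ⊆ Set.Iio y := by
  rw [level, level, denseRank_le_denseRank_iff]
  refine ⟨fun hle => (h.Iio_subset_or_subset x y).elim id fun hyx => ?_,
    fun hxy => Set.ncard_le_ncard hxy⟩
  exact (Set.eq_of_subset_of_ncard_le hyx hle).ge

lemma level_le_reach {x w : α} (h : ¬ x < w) : level w ≤ reach x :=
  Finset.le_sup (f := level) (by simpa using h)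

lemma exists_reach_eq_level (x : α) : ∃ w, ¬ x < w ∧ reach x = level w := by
  classical
  obtain ⟨w, hw, h⟩ := Finset.exists_mem_eq_sup (Finset.univ.filter fun w => ¬ x < w)
    ⟨x, by simp⟩ level
  exact ⟨w, by simpa using hw, h⟩

lemma lt_iff_reach_lt_level (h : TwoPlusTwoFree α) (x y : α) : x < y ↔ reach x < level y := by
  refine ⟨fun hxy => ?_, fun hlt => by_contra fun hxy => (level_le_reach hxy).not_gt hlt⟩
  obtain ⟨w, hxw, hw⟩ := exists_reach_eq_level x
  exact hw ▸ not_le.1 fun hle => hxw ((level_le_level_iff h).1 hle hxy)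

lemma exists_reach_eq (h : TwoPlusTwoFree α) (w : α) : ∃ x : α, reach x = level w := by
  by_cases htop : ∃ w' : α, level w' = level w + 1
  · obtain ⟨w', hw'⟩ := htop
    obtain ⟨x, hxw', hxw⟩ := Set.not_subset.1
      fun hsub => (hw'.symm.trans_le ((level_le_level_iff h).2 hsub)).not_gt (Nat.lt_succ_self _)
    have hlt : reach x < level w + 1 := hw' ▸ (lt_iff_reach_lt_level h x w').1 hxw'
    exact ⟨x, (Nat.lt_succ_iff.1 hlt).antisymm (level_le_reach hxw)⟩
  · obtain ⟨x, -, hx⟩ := Finite.exists_le_maximal (p := fun _ : α => True) (a := w) trivial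
    refine ⟨x, le_antisymm ?_ (level_le_reach (hx.not_gt trivial))⟩
    obtain ⟨v, -, hv⟩ := exists_reach_eq_level x
    by_contra! hlt
    exact htop (range_level.ge ((Nat.succ_le_of_lt (hv ▸ hlt)).trans_lt (range_level.le ⟨v, rfl⟩)))

variable (α) in
/-- The canonical interval representation of a finite `(2+2)`-free poset. -/
noncomputable def canonicalRep (x : α) : ℕ × ℕ := (level x, reach x)

theorem isCanonicalRep_canonicalRep (h : TwoPlusTwoFree α) :
    IsCanonicalRep (numLevels α) (canonicalRep α) where
  lt_iff := lt_iff_reach_lt_level h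
  range_fst := range_level
  range_snd := by
    rw [← range_level]
    refine Set.Subset.antisymm ?_ ?_
    · rintro _ ⟨x, rfl⟩
      obtain ⟨w, -, hw⟩ := exists_reach_eq_level x
      exact ⟨w, hw.symm⟩
    · rintro _ ⟨w, rfl⟩
      exact exists_reach_eq h w

end Existence

end CanonicalRepresentation

section Codes

/-- A multiset of intervals `(i, j)` with `i ≤ j` whose left endpoints are exactly `0, …, m - 1`,
and so are its right endpoints. -/
structure IsCode (m : ℕ) (s : Multiset (ℕ × ℕ)) : Prop where
  le_of_mem : ∀ p ∈ s, p.1 ≤ p.2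
  exists_fst_iff : ∀ i, (∃ p ∈ s, p.1 = i) ↔ i < m
  exists_snd_iff : ∀ j, (∃ p ∈ s, p.2 = j) ↔ j < m

lemma IsCanonicalRep.isCode {α : Type*} [Fintype α] [Preorder α] {m : ℕ} {f : α → ℕ × ℕ}
    (hf : IsCanonicalRep m f) : IsCode m (Finset.univ.val.map f) where
  le_of_mem p hp := by
    obtain ⟨x, -, rfl⟩ := Multiset.mem_map.1 hp
    exact hf.fst_le_snd x
  exists_fst_iff i := by simpa using Set.ext_iff.1 hf.range_fst i
  exists_snd_iff j := by simpa using Set.ext_iff.1 hf.range_snd j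

/-- The interval order of a family of intervals. -/
@[reducible] def intervalOrder {α : Type*} (f : α → ℕ × ℕ) (hf : ∀ x, (f x).1 ≤ (f x).2) :
    PartialOrder α where
  le x y := x = y ∨ (f x).2 < (f y).1
  lt x y := (f x).2 < (f y).1
  le_refl x := Or.inl rfl
  le_trans x y w := by grind
  le_antisymm x y := by grind
  lt_iff_le_not_ge x y := by grind

lemma exists_equiv_of_map_univ_eq {α β γ : Type*} [Fintype α] [Fintype β] {f : α → γ} {g : β → γ}
    (h : Finset.univ.val.map f = Finset.univ.val.map g) : ∃ e : α ≃ β, g ∘ e = f := by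
  classical
  have hfiber (c : γ) : Nonempty ({x // f x = c} ≃ {y // g y = c}) := by
    have hcount := congrArg (Multiset.countP (· = c)) h
    rw [Multiset.countP_map, Multiset.countP_map] at hcount
    refine ⟨Fintype.equivOfCardEq ?_⟩
    simpa [Fintype.card_subtype, Finset.card_def] using hcount
  let e (c : γ) := (hfiber c).some
  refine ⟨(Equiv.sigmaFiberEquiv f).symm.trans
    ((Equiv.sigmaCongrRight e).trans (Equiv.sigmaFiberEquiv g)), funext fun x => ?_⟩
  exact (e (f x) ⟨x, rfl⟩).2

lemma exists_map_univ_eq {γ : Type*} {n : ℕ} {s : Multiset γ} (h : Multiset.card s = n) :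
    ∃ f : Fin n → γ, Finset.univ.val.map f = s := by
  obtain ⟨l, rfl⟩ := Quot.exists_rep s
  obtain rfl : l.length = n := h
  exact ⟨l.get, by rw [Fin.univ_val_map, List.ofFn_get]; rfl⟩

variable {α β : Type*} [Fintype α] [Fintype β] [PartialOrder α] [PartialOrder β]

variable (α) in
/-- The multiset of intervals of the canonical representation of a finite `(2+2)`-free poset. -/
noncomputable def code : Multiset (ℕ × ℕ) := Finset.univ.val.map (canonicalRep α)

lemma card_code : Multiset.card (code α) = Fintype.card α := by simp [code]

lemma IsCanonicalRep.code_eq {m : ℕ} {f : α → ℕ × ℕ} (hf : IsCanonicalRep m f) :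
    code α = Finset.univ.val.map f := by
  rw [code, hf.unique (isCanonicalRep_canonicalRep hf.twoPlusTwoFree)]

lemma TwoPlusTwoFree.numMin_eq_countP (h : TwoPlusTwoFree α) :
    numMin α = (code α).countP (·.1 = 0) := by
  classical
  simp only [numMin, code, Multiset.countP_map, (isCanonicalRep_canonicalRep h).fst_eq_zero_iff]
  rw [← Finset.filter_val, Finset.card_val, Set.ncard_eq_toFinset_card', Set.toFinset_ofPred]

theorem nonempty_orderIso_iff_code_eq (hα : TwoPlusTwoFree α) (hβ : TwoPlusTwoFree β) :
    Nonempty (α ≃o β) ↔ code α = code β := by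
  have hrepα := isCanonicalRep_canonicalRep hα
  have hrepβ := isCanonicalRep_canonicalRep hβ
  constructor
  · rintro ⟨e⟩
    rw [(hrepβ.comp_orderIso e).code_eq, ← Multiset.map_map]
    exact congrArg _ (Multiset.map_univ_val_equiv e.toEquiv)
  · intro h
    obtain ⟨e, he⟩ := exists_equiv_of_map_univ_eq h
    have hlt (x y : α) : e x < e y ↔ x < y := by
      rw [hrepα.lt_iff, hrepβ.lt_iff, ← he]
      rfl
    refine ⟨⟨e, fun {x y} => ?_⟩⟩
    rw [le_iff_lt_or_eq, le_iff_lt_or_eq, hlt, e.injective.eq_iff]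

lemma IsCode.exists_partialOrder {α : Type*} [Fintype α] {m : ℕ} {f : α → ℕ × ℕ}
    (hm : IsCode m (Finset.univ.val.map f)) :
    ∃ _ : PartialOrder α, TwoPlusTwoFree α ∧ code α = Finset.univ.val.map f := by
  let P := intervalOrder f fun x => hm.le_of_mem _ (by simp)
  have hrep : IsCanonicalRep m f :=
    { lt_iff := fun _ _ => Iff.rfl
      range_fst := Set.ext fun i => by simpa using hm.exists_fst_iff i
      range_snd := Set.ext fun j => by simpa using hm.exists_snd_iff j }
  exact ⟨P, hrep.twoPlusTwoFree, hrep.code_eq⟩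

theorem posetCount_eq_card_codes (n k : ℕ) : posetCount n k =
    Nat.card {s : Multiset (ℕ × ℕ) // (∃ m, IsCode m s) ∧ Multiset.card s = n ∧
      s.countP (·.1 = 0) = k} := by
  refine Nat.card_congr (Equiv.ofBijective (Quotient.lift (fun P : LabeledPoset n k =>
    letI := P.1
    ⟨code (Fin n), ⟨_, (isCanonicalRep_canonicalRep P.2.1).isCode⟩,
      card_code.trans (Fintype.card_fin n), P.2.1.numMin_eq_countP.symm.trans P.2.2⟩) ?_) ⟨?_, ?_⟩)
  · exact fun P R h => Subtype.ext
      ((@nonempty_orderIso_iff_code_eq _ _ _ _ P.1 R.1 P.2.1 R.2.1).1 h)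
  · rintro ⟨P⟩ ⟨R⟩ h
    exact Quotient.sound ((@nonempty_orderIso_iff_code_eq _ _ _ _ P.1 R.1 P.2.1 R.2.1).2
      (congrArg Subtype.val h))
  · rintro ⟨s, ⟨m, hm⟩, hn, hk⟩
    obtain ⟨f, rfl⟩ := exists_map_univ_eq hn
    obtain ⟨P, hfree, hcode⟩ := hm.exists_partialOrder
    refine ⟨Quotient.mk _ ⟨P, hfree, ?_⟩, Subtype.ext hcode⟩
    exact (@TwoPlusTwoFree.numMin_eq_countP _ _ P hfree).trans (hcode ▸ hk)

end Codes

/-! ### Upper triangular matrices -/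

section Matrices

open Matrix

/-- The upper triangular matrices with entries at most `N` and without zero rows. -/
def upperMats (N m : ℕ) : Finset (Matrix (Fin m) (Fin m) ℕ) :=
  Fintype.piFinset fun i =>
    (Fintype.piFinset fun j => if i ≤ j then Finset.range (N + 1) else {0}).erase 0

lemma mem_upperMats {N m : ℕ} {M : Matrix (Fin m) (Fin m) ℕ} :
    M ∈ upperMats N m ↔ ∀ i, M i ≠ 0 ∧ ∀ j, M i j ≤ N ∧ (j < i → M i j = 0) := by
  refine Fintype.mem_piFinset.trans ?_
  simp only [Finset.mem_erase, Fintype.mem_piFinset]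
  refine forall_congr' fun i => and_congr_right fun _ => forall_congr' fun j => ?_
  split_ifs with h
  · simp [h]
  · simp only [Finset.mem_singleton]
    grind

/-- The matrix with first row `r`, lower right block `M` and zeros below the first diagonal
entry. -/
def consRow {m : ℕ} (r : Fin (m + 1) → ℕ) (M : Matrix (Fin m) (Fin m) ℕ) :
    Matrix (Fin (m + 1)) (Fin (m + 1)) ℕ :=
  of (vecCons r fun i => vecCons 0 (M i))

lemma consRow_mem_upperMats {N m : ℕ} {r : Fin (m + 1) → ℕ} {M : Matrix (Fin m) (Fin m) ℕ} :
    consRow r M ∈ upperMats N (m + 1) ↔ (r ≠ 0 ∧ ∀ j, r j ≤ N) ∧ M ∈ upperMats N m := by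
  have hzero : consRow r M 0 = r := rfl
  have hsucc (i : Fin m) : consRow r M i.succ = vecCons 0 (M i) := rfl
  simp [mem_upperMats, Fin.forall_fin_succ (n := m), hzero, hsucc, cons_eq_zero_iff]

lemma consRow_submatrix_succ {N m : ℕ} {M : Matrix (Fin (m + 1)) (Fin (m + 1)) ℕ}
    (hM : M ∈ upperMats N (m + 1)) : consRow (M 0) (M.submatrix Fin.succ Fin.succ) = M := by
  ext i j
  cases i using Fin.cases with
  | zero => rfl
  | succ i =>
    cases j using Fin.cases with
    | zero => exact (((mem_upperMats.1 hM i.succ).2 0).2 (Fin.succ_pos i)).symm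
    | succ j => rfl

lemma col_consRow {m : ℕ} (r : Fin (m + 1) → ℕ) (M : Matrix (Fin m) (Fin m) ℕ)
    (j : Fin (m + 1)) :
    (consRow r M).col j = vecCons (r j) (vecCons 0 M.col j : Fin m → ℕ) := by
  ext i
  cases i using Fin.cases <;> cases j using Fin.cases <;> rfl

lemma sum_upperMats_succ {Q : Type*} [AddCommMonoid Q] (N m : ℕ)
    (f : Matrix (Fin (m + 1)) (Fin (m + 1)) ℕ → Q) :
    ∑ M ∈ upperMats N (m + 1), f M = ∑ M ∈ upperMats N m,
      ∑ r ∈ (Fintype.piFinset fun _ => Finset.range (N + 1)).erase 0, f (consRow r M) := by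
  rw [← Finset.sum_product']
  symm
  refine Finset.sum_nbij' (fun p => consRow p.2 p.1)
    (fun M => (M.submatrix Fin.succ Fin.succ, M 0)) (fun p hp => ?_) (fun M hM => ?_)
    (fun p _ => rfl) (fun M hM => consRow_submatrix_succ hM) fun p _ => rfl
  · simpa [consRow_mem_upperMats, Nat.lt_succ_iff, and_comm] using hp
  · rw [← consRow_submatrix_succ hM, consRow_mem_upperMats] at hM
    simpa [Nat.lt_succ_iff, and_comm] using hM

variable {Q : Type*} [CommRing Q]

/-- The weight of a nonzero column that consists of `c` beneath an auxiliary entry. The auxiliary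
entry has total weight `A`, of which `1` belongs to the entry `0`. -/
def columnWeight (A : Q) {m : ℕ} (x : Fin m → Q) (c : Fin m → ℕ) : Q :=
  A * ∏ i, x i ^ c i - if c = 0 then 1 else 0

lemma columnWeight_zero (A : Q) {m : ℕ} (x : Fin m → Q) : columnWeight A x 0 = A - 1 := by
  simp [columnWeight]

lemma columnWeight_cons_zero (A : Q) {m : ℕ} (x : Fin (m + 1) → Q) (c : Fin m → ℕ) :
    columnWeight A x (vecCons 0 c) = columnWeight A (vecTail x) c := by
  simp [columnWeight, Fin.prod_univ_succ, vecTail, cons_eq_zero_iff]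

lemma sum_columnWeight_cons (A : Q) {m : ℕ} (x : Fin (m + 1) → Q) (c : Fin m → ℕ) (N : ℕ) :
    ∑ k ∈ Finset.range (N + 1), columnWeight A x (vecCons k c)
      = columnWeight (A * ∑ k ∈ Finset.range (N + 1), x 0 ^ k) (vecTail x) c := by
  simp only [columnWeight, Finset.sum_sub_distrib, Fin.prod_univ_succ, cons_val_zero, cons_val_succ,
    cons_eq_zero_iff, ite_and, Finset.sum_ite_eq', Finset.mem_range, Nat.succ_pos, if_true, vecTail,
    Function.comp_apply,     Finset.mul_sum, Finset.sum_mul, mul_assoc]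

/-- The sum of the weights of all upper triangular matrices with entries at most `N` beneath an
auxiliary row of entries of total weight `A`, such that all rows except possibly the auxiliary one
and all columns are nonzero; an entry `k` in row `i` has weight `x i ^ k`. -/
def augSum (N : ℕ) (A : Q) {m : ℕ} (x : Fin m → Q) : Q :=
  ∑ M ∈ upperMats N m, ∏ j, columnWeight A x (M.col j)

lemma augSum_zero (N : ℕ) (A : Q) (x : Fin 0 → Q) : augSum N A x = 1 := by
  have hcard : (upperMats N 0).card = 1 :=
    (Fintype.card_piFinset _).trans (Fin.prod_univ_zero _)
  simp [augSum, hcard]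

lemma augSum_succ (N : ℕ) (A : Q) {m : ℕ} (x : Fin (m + 1) → Q) {y : Q}
    (hy : ∑ k ∈ Finset.range (N + 1), x 0 ^ k = y) :
    augSum N A x
      = (A * y - 1) * augSum N (A * y) (vecTail x) - (A - 1) * augSum N A (vecTail x) := by
  have hrow (c : Fin (m + 1) → Fin m → ℕ) :
      ∑ r ∈ (Fintype.piFinset fun _ => Finset.range (N + 1)).erase (0 : Fin (m + 1) → ℕ),
        ∏ j, columnWeight A x (vecCons (r j) (c j))
      = ∏ j, columnWeight (A * y) (vecTail x) (c j) - ∏ j, columnWeight A (vecTail x) (c j) := by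
    rw [Finset.sum_erase_eq_sub (by simp), ← Finset.prod_univ_sum (fun _ => Finset.range (N + 1))
      fun j k => columnWeight A x (vecCons k (c j))]
    simp only [sum_columnWeight_cons, hy, Pi.zero_apply, columnWeight_cons_zero]
  simp only [augSum, sum_upperMats_succ, col_consRow, hrow]
  simp only [Fin.prod_univ_succ, cons_val_zero, cons_val_succ, columnWeight_zero,
    Finset.sum_sub_distrib, Finset.mul_sum]

/-- The upper triangular matrices with entries at most `N` and without zero rows and zero
columns. -/
def fishburnMats (N m : ℕ) : Finset (Matrix (Fin m) (Fin m) ℕ) :=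
  (upperMats N m).filter fun M => ∀ j, M.col j ≠ 0

lemma augSum_one (N : ℕ) {m : ℕ} (x : Fin m → Q) :
    augSum N 1 x = ∑ M ∈ fishburnMats N m, ∏ j, ∏ i, x i ^ M i j := by
  rw [fishburnMats, Finset.sum_filter]
  refine Finset.sum_congr rfl fun M _ => ?_
  split_ifs with h
  · exact Finset.prod_congr rfl fun j _ => by simp [columnWeight, h j]
  · obtain ⟨j, hj⟩ := not_forall_not.1 h
    exact Finset.prod_eq_zero (Finset.mem_univ j) (by rw [hj, columnWeight_zero, sub_self])

end Matrices

section MatrixCodes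

open Matrix

/-- The multiset of positions (row, column) in which each position occurs as often as the entry of
`M` says. -/
def toCode {m : ℕ} (M : Matrix (Fin m) (Fin m) ℕ) : Multiset (ℕ × ℕ) :=
  ∑ j, ∑ i, Multiset.replicate (M i j) ((i : ℕ), (j : ℕ))

lemma mem_toCode {m : ℕ} {M : Matrix (Fin m) (Fin m) ℕ} {p : ℕ × ℕ} :
    p ∈ toCode M ↔ ∃ i j : Fin m, M i j ≠ 0 ∧ p = (↑i, ↑j) := by
  rw [exists_comm]
  simp [toCode, Multiset.mem_sum, Multiset.mem_replicate]

lemma count_toCode {m : ℕ} (M : Matrix (Fin m) (Fin m) ℕ) (i j : Fin m) :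
    (toCode M).count (↑i, ↑j) = M i j := by
  simp [toCode, Multiset.count_sum', Multiset.count_replicate, Fin.val_inj, ite_and]

lemma toCode_injective (m : ℕ) : Function.Injective (toCode (m := m)) := fun M M' h => by
  ext i j
  rw [← count_toCode M, h, count_toCode M']

lemma isCode_toCode {N m : ℕ} {M : Matrix (Fin m) (Fin m) ℕ} (hM : M ∈ fishburnMats N m) :
    IsCode m (toCode M) := by
  obtain ⟨hupper, hcol⟩ := Finset.mem_filter.1 hM
  rw [mem_upperMats] at hupper
  refine ⟨fun p hp => ?_, fun i => ⟨?_, fun hi => ?_⟩, fun j => ⟨?_, fun hj => ?_⟩⟩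
  · obtain ⟨i, j, hij, rfl⟩ := mem_toCode.1 hp
    exact not_lt.1 fun hlt => hij (((hupper i).2 j).2 hlt)
  · rintro ⟨p, hp, rfl⟩
    obtain ⟨i, j, -, rfl⟩ := mem_toCode.1 hp
    exact i.2
  · obtain ⟨j, hj⟩ := Function.ne_iff.1 (hupper ⟨i, hi⟩).1
    exact ⟨_, mem_toCode.2 ⟨⟨i, hi⟩, j, hj, rfl⟩, rfl⟩
  · rintro ⟨p, hp, rfl⟩
    obtain ⟨i, j, -, rfl⟩ := mem_toCode.1 hp
    exact j.2
  · obtain ⟨i, hi⟩ := Function.ne_iff.1 (hcol ⟨j, hj⟩)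
    exact ⟨_, mem_toCode.2 ⟨i, ⟨j, hj⟩, hi, rfl⟩, rfl⟩

lemma IsCode.le_card {m : ℕ} {s : Multiset (ℕ × ℕ)} (h : IsCode m s) : m ≤ Multiset.card s := by
  have hsub : Finset.range m ⊆ (s.map Prod.fst).toFinset := fun i hi => by
    obtain ⟨p, hp, rfl⟩ := (h.exists_fst_iff i).2 (Finset.mem_range.1 hi)
    simpa using ⟨_, hp⟩
  simpa using (Finset.card_le_card hsub).trans (Multiset.toFinset_card_le _)

lemma IsCode.unique {m n : ℕ} {s : Multiset (ℕ × ℕ)} (hm : IsCode m s) (hn : IsCode n s) :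
    m = n :=
  eq_of_forall_lt_iff fun i => (hm.exists_fst_iff i).symm.trans (hn.exists_fst_iff i)

lemma IsCode.exists_toCode_eq {N m : ℕ} {s : Multiset (ℕ × ℕ)} (h : IsCode m s)
    (hs : Multiset.card s ≤ N) : ∃ M ∈ fishburnMats N m, toCode M = s := by
  refine ⟨Matrix.of fun i j => s.count (↑i, ↑j), Finset.mem_filter.2
    ⟨mem_upperMats.2 fun i => ⟨?_, fun j => ⟨(Multiset.count_le_card _ _).trans hs, fun hlt =>
      Multiset.count_eq_zero.2 fun hp => (h.le_of_mem _ hp).not_gt hlt⟩⟩, fun j => ?_⟩, ?_⟩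
  · obtain ⟨p, hp, hpi⟩ := (h.exists_fst_iff i).2 i.2
    exact Function.ne_iff.2 ⟨⟨p.2, (h.exists_snd_iff p.2).1 ⟨p, hp, rfl⟩⟩,
      Multiset.count_ne_zero.2 (hpi ▸ hp)⟩
  · obtain ⟨p, hp, hpj⟩ := (h.exists_snd_iff j).2 j.2
    exact Function.ne_iff.2 ⟨⟨p.1, (h.exists_fst_iff p.1).1 ⟨p, hp, rfl⟩⟩,
      Multiset.count_ne_zero.2 (hpj ▸ hp)⟩
  · ext ⟨a, b⟩
    by_cases hab : a < m ∧ b < m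
    · exact count_toCode _ ⟨a, hab.1⟩ ⟨b, hab.2⟩
    · rw [Multiset.count_eq_zero_of_notMem, Multiset.count_eq_zero_of_notMem]
      · exact fun hp =>
          hab ⟨(h.exists_fst_iff a).1 ⟨_, hp, rfl⟩, (h.exists_snd_iff b).1 ⟨_, hp, rfl⟩⟩
      · intro hp
        obtain ⟨i, j, -, he⟩ := mem_toCode.1 hp
        obtain ⟨rfl, rfl⟩ := Prod.mk.inj he
        exact hab ⟨i.2, j.2⟩

/-- The codes of all matrices in `fishburnMats N m` with `m ≤ N`. -/
def fishburnCodes (N : ℕ) : Finset (Multiset (ℕ × ℕ)) :=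
  (Finset.range (N + 1)).biUnion fun m => (fishburnMats N m).image toCode

lemma posetCount_eq_card_filter {N n : ℕ} (hn : n ≤ N) (k : ℕ) :
    posetCount n k = ((fishburnCodes N).filter fun s =>
      Multiset.card s = n ∧ s.countP (·.1 = 0) = k).card := by
  rw [posetCount_eq_card_codes]
  refine Nat.subtype_card _ fun s => ?_
  rw [Finset.mem_filter]
  refine and_congr_left fun ⟨hs, _⟩ => ?_
  simp only [fishburnCodes, Finset.mem_biUnion, Finset.mem_image, Finset.mem_range]
  constructor
  · rintro ⟨m, -, M, hM, rfl⟩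
    exact ⟨m, isCode_toCode hM⟩
  · rintro ⟨m, hm⟩
    have := hm.le_card
    exact ⟨m, by omega, hm.exists_toCode_eq (by omega)⟩

variable {Q : Type*} [CommRing Q]

lemma prod_map_weight (t z : Q) (s : Multiset (ℕ × ℕ)) :
    (s.map fun p => if p.1 = 0 then z * t else t).prod
      = t ^ Multiset.card s * z ^ s.countP (·.1 = 0) := by
  induction s using Multiset.induction_on with
  | empty => simp
  | cons p s ih =>
    rw [Multiset.map_cons, Multiset.prod_cons, ih, Multiset.card_cons, Multiset.countP_cons]
    split_ifs <;> ring

lemma weight_toCode (t z : Q) {m : ℕ} (M : Matrix (Fin m) (Fin m) ℕ) :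
    t ^ Multiset.card (toCode M) * z ^ (toCode M).countP (·.1 = 0)
      = ∏ j, ∏ i : Fin m, (if (i : ℕ) = 0 then z * t else t) ^ M i j := by
  rw [← prod_map_weight, toCode, ← Multiset.coe_mapAddMonoidHom]
  simp only [map_sum, Multiset.prod_sum, Multiset.coe_mapAddMonoidHom, Multiset.map_replicate,
    Multiset.prod_replicate]

lemma sum_fishburnCodes (N : ℕ) (t z : Q) :
    ∑ s ∈ fishburnCodes N, t ^ Multiset.card s * z ^ s.countP (·.1 = 0)
      = ∑ m ∈ Finset.range (N + 1),
          augSum N 1 fun i : Fin m => if (i : ℕ) = 0 then z * t else t := by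
  rw [fishburnCodes, Finset.sum_biUnion]
  · refine Finset.sum_congr rfl fun m _ => ?_
    rw [Finset.sum_image (toCode_injective m).injOn, augSum_one]
    exact Finset.sum_congr rfl fun M _ => weight_toCode t z M
  · intro m _ n _ hmn
    refine Finset.disjoint_left.2 fun s hs hs' => hmn ?_
    obtain ⟨M, hM, rfl⟩ := Finset.mem_image.1 hs
    obtain ⟨M', hM', he⟩ := Finset.mem_image.1 hs'
    exact (isCode_toCode hM).unique (he ▸ isCode_toCode hM')

end MatrixCodes

/-! ### The functional equation -/

section FunctionalEquation

variable {Q : Type*} [CommRing Q]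

lemma sum_range_pow_eq {c w : Q} {n : ℕ} (hc : c ^ n = 0) (hw : (1 - c) * w = 1) :
    ∑ k ∈ Finset.range n, c ^ k = w := by
  have hgeom := mul_neg_geom_sum c n
  linear_combination w * hgeom - w * hc - (∑ k ∈ Finset.range n, c ^ k) * hw

lemma dvd_mul_sub_one {t a b : Q} (ha : t ∣ a - 1) (hb : t ∣ b - 1) : t ∣ a * b - 1 := by
  obtain ⟨c, hc⟩ := ha
  obtain ⟨d, hd⟩ := hb
  exact ⟨c * b + d, by linear_combination b * hc + hd⟩

lemma isUnit_of_dvd_sub_one {t a : Q} {n : ℕ} (ht : t ^ n = 0) (ha : t ∣ a - 1) : IsUnit a := by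
  obtain ⟨c, hc⟩ := ha
  have hnil : IsNilpotent (a - 1) := ⟨n, by rw [hc, mul_pow, ht, zero_mul]⟩
  simpa using hnil.isUnit_one_add

lemma eq_of_functionalEquation {t v : Q} {n : ℕ} (ht : t ^ n = 0) (hv : t ∣ v - 1) {f g : Q → Q}
    (hf : ∀ a, t ∣ a - 1 → a * f a = 1 + (a * v - 1) * f (a * v))
    (hg : ∀ a, t ∣ a - 1 → a * g a = 1 + (a * v - 1) * g (a * v))
    {a : Q} (ha : t ∣ a - 1) : f a = g a := by
  suffices ∀ k a, t ∣ a - 1 → t ^ k ∣ f a - g a by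
    rw [← sub_eq_zero, ← zero_dvd_iff, ← ht]
    exact this n a ha
  intro k
  induction k with
  | zero => simp
  | succ k ih =>
    intro a ha
    have hav := dvd_mul_sub_one ha hv
    have hdiff : a * (f a - g a) = (a * v - 1) * (f (a * v) - g (a * v)) := by
      linear_combination hf a ha - hg a ha
    rw [← (isUnit_of_dvd_sub_one ht ha).dvd_mul_left, hdiff, pow_succ']
    exact mul_dvd_mul hav (ih _ hav)

lemma sum_qPochhammer_functionalEquation {q v : Q} {N : ℕ} (hq : (1 - q) ^ (N + 1) = 0)
    (hv : q * v = 1) (a : Q) :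
    a * ∑ n ∈ Finset.range (N + 1), a ^ n * qPochhammer q n
      = 1 + (a * v - 1) * ∑ n ∈ Finset.range (N + 1), (a * v) ^ n * qPochhammer q n := by
  have hlast : qPochhammer q (N + 1) = 0 :=
    eq_zero_of_pow_dvd hq N.lt_succ_self (one_sub_pow_dvd_qPochhammer q _)
  have hterm (n : ℕ) : a * (a ^ n * qPochhammer q n)
      = a * v * ((a * v) ^ n * qPochhammer q n) - (a * v) ^ (n + 1) * qPochhammer q (n + 1) := by
    have hpow : (q * v) ^ (n + 1) = 1 := by rw [hv, one_pow]
    rw [mul_pow] at hpow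
    rw [qPochhammer_succ, mul_pow]
    linear_combination (-a ^ (n + 1) * qPochhammer q n) * hpow
  have hshift : ∑ n ∈ Finset.range (N + 1), (a * v) ^ (n + 1) * qPochhammer q (n + 1)
      = ∑ n ∈ Finset.range (N + 1), (a * v) ^ n * qPochhammer q n - 1 := by
    rw [Finset.sum_range_succ, hlast, Finset.sum_range_succ', qPochhammer_zero]
    ring
  rw [Finset.mul_sum, Finset.sum_congr rfl fun n _ => hterm n, Finset.sum_sub_distrib, hshift,
    ← Finset.mul_sum]
  ring

lemma dvd_geom_sum_sub_one {t c : Q} (hc : t ∣ c) (N : ℕ) :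
    t ∣ ∑ k ∈ Finset.range (N + 1), c ^ k - 1 := by
  rw [Finset.sum_range_succ', pow_zero, add_sub_cancel_right]
  exact Finset.dvd_sum fun k _ => hc.trans (dvd_pow_self c k.succ_ne_zero)

lemma pow_dvd_augSum {t : Q} (N m : ℕ) {a : Q} (ha : t ∣ a - 1) :
    t ^ m ∣ augSum N a fun _ : Fin m => t := by
  induction m generalizing a with
  | zero => simp
  | succ m ih =>
    have hav := dvd_mul_sub_one ha (dvd_geom_sum_sub_one dvd_rfl N)
    rw [augSum_succ N a _ rfl, pow_succ']
    exact (mul_dvd_mul hav (ih hav)).sub (mul_dvd_mul ha (ih ha))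

lemma sum_augSum_eq_of_first_row {t c w : Q} {N : ℕ} (ht : t ^ (N + 1) = 0) (hct : t ∣ c)
    (hw : ∑ k ∈ Finset.range (N + 1), c ^ k = w) {a : Q} (ha : t ∣ a - 1) :
    ∑ m ∈ Finset.range (N + 1), augSum N a (fun i : Fin m => if (i : ℕ) = 0 then c else t)
      = 1 + (a * w - 1) * ∑ m ∈ Finset.range (N + 1), augSum N (a * w) (fun _ : Fin m => t)
        - (a - 1) * ∑ m ∈ Finset.range (N + 1), augSum N a (fun _ : Fin m => t) := by
  have haw : t ∣ a * w - 1 := dvd_mul_sub_one ha (hw ▸ dvd_geom_sum_sub_one hct N)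
  have hlast {b : Q} (hb : t ∣ b - 1) : (b - 1) * augSum N b (fun _ : Fin N => t) = 0 :=
    eq_zero_of_pow_dvd ht N.lt_succ_self
      (pow_succ' t N ▸ mul_dvd_mul hb (pow_dvd_augSum N N hb))
  have hpeel (m : ℕ) : augSum N a (fun i : Fin (m + 1) => if (i : ℕ) = 0 then c else t)
      = (a * w - 1) * augSum N (a * w) (fun _ : Fin m => t)
        - (a - 1) * augSum N a (fun _ : Fin m => t) := augSum_succ N a _ hw
  rw [Finset.sum_range_succ', augSum_zero, Finset.sum_congr rfl fun m _ => hpeel m,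
    Finset.sum_sub_distrib, ← Finset.mul_sum, ← Finset.mul_sum, Finset.sum_range_succ _ N,
    Finset.sum_range_succ _ N, mul_add, mul_add, hlast ha, hlast haw]
  ring

lemma sum_augSum_eq {t : Q} {N : ℕ} (ht : t ^ (N + 1) = 0) {a : Q} (ha : t ∣ a - 1) :
    ∑ m ∈ Finset.range (N + 1), augSum N a (fun _ : Fin m => t)
      = ∑ n ∈ Finset.range (N + 1), a ^ n * qPochhammer (1 - t) n := by
  have hgeom : (1 - t) * ∑ k ∈ Finset.range (N + 1), t ^ k = 1 := by
    rw [mul_neg_geom_sum, ht, sub_zero]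
  refine eq_of_functionalEquation
    (f := fun a => ∑ m ∈ Finset.range (N + 1), augSum N a fun _ : Fin m => t)
    (g := fun a => ∑ n ∈ Finset.range (N + 1), a ^ n * qPochhammer (1 - t) n)
    ht (dvd_geom_sum_sub_one dvd_rfl N) (fun b hb => ?_)
    (fun b _ => sum_qPochhammer_functionalEquation (by rwa [sub_sub_cancel]) hgeom b) ha
  have hfirst := sum_augSum_eq_of_first_row ht dvd_rfl rfl hb
  simp only [ite_self] at hfirst
  linear_combination hfirst

theorem truncGenFun_posetCount {t z u : Q} {N : ℕ} (ht : t ^ (N + 1) = 0)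
    (hu : (1 - z * t) * u = 1) : truncGenFun posetCount N t z = truncSeries N t z u := by
  have hgeom : ∑ k ∈ Finset.range (N + 1), (z * t) ^ k = u :=
    sum_range_pow_eq (by rw [mul_pow, ht, mul_zero]) hu
  rw [truncGenFun_eq_sum z ht (fishburnCodes N) Multiset.card (Multiset.countP (·.1 = 0))
      (fun _ _ => Multiset.countP_le_card _ _) fun _ hn k => posetCount_eq_card_filter hn k,
    sum_fishburnCodes, sum_augSum_eq_of_first_row ht (dvd_mul_left t z) hgeom (by simp), one_mul,
    sub_self, zero_mul, sub_zero, sum_augSum_eq ht ⟨z * u, by linear_combination hu⟩, truncSeries,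
    Finset.mul_sum, Finset.mul_sum]
  refine congrArg _ (Finset.sum_congr rfl fun n _ => ?_)
  linear_combination (u ^ n * qPochhammer (1 - t) n) * hu

end FunctionalEquation

/-! ### Transfer to formal power series -/

section PowerSeries

lemma map_truncGenFun {R S : Type*} [CommRing R] [CommRing S] (φ : R →+* S) (c : ℕ → ℕ → ℕ) (N : ℕ)
    (t z : R) : φ (truncGenFun c N t z) = truncGenFun c N (φ t) (φ z) := by
  simp [truncGenFun]

lemma map_truncSeries {R S : Type*} [CommRing R] [CommRing S] (φ : R →+* S) (N : ℕ) (t z u : R) :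
    φ (truncSeries N t z u) = truncSeries N (φ t) (φ z) (φ u) := by
  simp [truncSeries, qPochhammer]

lemma one_sub_mul_inv : (1 - z * t) * MvPowerSeries.invOfUnit (1 - z * t) 1 = 1 :=
  MvPowerSeries.mul_invOfUnit _ _ (by simp [z, t])

lemma term_eq (n : ℕ) : term n
    = z * t * (MvPowerSeries.invOfUnit (1 - z * t) 1 ^ (n + 1) * qPochhammer (1 - t) n) :=
  mul_assoc _ _ _

lemma coeff_term_eq_zero {n : ℕ} {d : Fin 2 →₀ ℕ} (h : d 0 < n) :
    MvPowerSeries.coeff d (term n) = 0 := by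
  have hdvd : t ^ n ∣ term n := by
    rw [term_eq]
    have := one_sub_pow_dvd_qPochhammer (1 - t) n
    rw [sub_sub_cancel] at this
    exact (this.mul_left _).mul_left _
  exact MvPowerSeries.X_pow_dvd_iff.1 hdvd d h

lemma hasSum_coeff_term {N : ℕ} {d : Fin 2 →₀ ℕ} (h : d 0 ≤ N) :
    HasSum (fun n => MvPowerSeries.coeff d (term n))
      (∑ n ∈ Finset.range (N + 1), MvPowerSeries.coeff d (term n)) :=
  hasSum_sum_of_ne_finset_zero fun n hn => coeff_term_eq_zero (by simp at hn; omega)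

theorem summable_term : Summable term :=
  Pi.summable.2 fun _ => (hasSum_coeff_term le_rfl).summable

lemma coeff_tsum_term {N : ℕ} {d : Fin 2 →₀ ℕ} (h : d 0 ≤ N) :
    MvPowerSeries.coeff d (∑' n, term n)
      = MvPowerSeries.coeff d (∑ n ∈ Finset.range (N + 1), term n) := by
  rw [map_sum]
  exact (Pi.hasSum.1 summable_term.hasSum d).unique (hasSum_coeff_term h)

lemma truncSeries_eq_one_add_sum_term (N : ℕ) :
    truncSeries N t z (MvPowerSeries.invOfUnit (1 - z * t) 1)
      = 1 + ∑ n ∈ Finset.range (N + 1), term n := by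
  simp only [truncSeries, term_eq, Finset.mul_sum]

lemma coeff_truncGenFun (c : ℕ → ℕ → ℕ) {N : ℕ} {d : Fin 2 →₀ ℕ} (h0 : d 0 ≤ N) (h1 : d 1 ≤ N) :
    MvPowerSeries.coeff d (truncGenFun c N t z) = c (d 0) (d 1) := by
  have hd (n k : ℕ) : d = Finsupp.single 0 n + Finsupp.single 1 k ↔ d 0 = n ∧ d 1 = k := by
    simp [Finsupp.ext_iff, Fin.forall_fin_two]
  have hmonomial (n k : ℕ) :
      MvPowerSeries.coeff d ((c n k : MvPowerSeries (Fin 2) ℤ) * (t ^ n * z ^ k))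
        = if d 0 = n ∧ d 1 = k then (c n k : ℤ) else 0 := by
    rw [← nsmul_eq_mul, map_nsmul, t, z, MvPowerSeries.X_pow_eq, MvPowerSeries.X_pow_eq,
      MvPowerSeries.monomial_mul_monomial, MvPowerSeries.coeff_monomial, if_congr (hd n k) rfl rfl]
    simp
  simp only [truncGenFun, map_sum, hmonomial, ite_and, Finset.sum_ite_irrel, Finset.sum_const_zero,
    Finset.sum_ite_eq, Finset.mem_range, Nat.lt_succ_iff, h0, h1, if_true]

theorem genFun_eq_of_truncGenFun_eq (c : ℕ → ℕ → ℕ)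
    (hc : ∀ {Q : Type} [CommRing Q] {t z u : Q} {N : ℕ}, t ^ (N + 1) = 0 → (1 - z * t) * u = 1 →
      truncGenFun c N t z = truncSeries N t z u) :
    genFun c = 1 + ∑' n, term n := by
  ext d
  let N := d 0 + d 1
  let π := Ideal.Quotient.mk (Ideal.span {t ^ (N + 1)})
  have ht : π t ^ (N + 1) = 0 := by
    rw [← map_pow]
    exact Ideal.Quotient.eq_zero_iff_mem.2 (Ideal.mem_span_singleton_self _)
  have hu : (1 - π z * π t) * π (MvPowerSeries.invOfUnit (1 - z * t) 1) = 1 := by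
    rw [← map_mul, ← map_one π, ← map_sub, ← map_mul, one_sub_mul_inv]
  have hmod := hc ht hu
  rw [← map_truncGenFun, ← map_truncSeries, truncSeries_eq_one_add_sum_term, Ideal.Quotient.eq,
    Ideal.mem_span_singleton] at hmod
  have hcoeff := MvPowerSeries.X_pow_dvd_iff.1 hmod d (by omega)
  rw [map_sub, sub_eq_zero, coeff_truncGenFun c (by omega) (by omega), map_add] at hcoeff
  rw [map_add, coeff_tsum_term (N := N) (by omega)]
  exact hcoeff

end PowerSeries

end FishburnMin

/- The infinite sum is taken coefficientwise: the topology on power series is the product topology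
of the discrete topology of `ℤ`. -/
theorem theorem4p2 :
    Summable FishburnMin.term ∧
      FishburnMin.genFun FishburnMin.posetCount = 1 + ∑' n : ℕ, FishburnMin.term n ∧
      FishburnMin.genFun FishburnMin.ascentCount = 1 + ∑' n : ℕ, FishburnMin.term n :=
  ⟨FishburnMin.summable_term,
    FishburnMin.genFun_eq_of_truncGenFun_eq _ FishburnMin.truncGenFun_posetCount,
    FishburnMin.genFun_eq_of_truncGenFun_eq _ FishburnMin.truncGenFun_ascentCount⟩
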